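/- Let $d\in\{2,3\}$, $k_d=2^d-1$, $\mathbb{R}_\infty=\mathbb{R}\cup\{\infty\}$. Let $$\Pi_d=\{P\,\mathrm{diag}(\varepsilon) : P \text{ a } d\times d \text{ permutation matrix},\ \varepsilon\in\{-1,1\}^d,\ \varepsilon_1\cdots\varepsilon_d=1\},$$ and call $\Phi:\mathbb{R}^d\to\mathbb{R}_\infty$ $\Pi_d$-invariant if $\Phi(S\hat\nu)=\Phi(\hat\nu)$ for all $S\in\Pi_d$ and $\hat\nu\in\mathbb{R}^d$. A vector $\nu\in\mathbb{R}^d$ is a vector of signed singular values of $F\in\mathbb{R}^{d\times d}$ if $|\nu_1|,\dots,|\nu_d|$ are, in some order, the singular values of $F$ with multiplicity, and $\mathrm{sign}(\nu_1\cdots\nu_d)=\mathrm{sign}(\det F)$. Such a vector exists and is unique up to the action of $\Pi_d$; write $\nu(F)$ for any choice of it. A function $V:\mathbb{R}^{d\times d}\to\mathbb{R}_\infty$ is lower semicontinuous polyconvex if there is a convex lower semicontinuous function $G$ with values in $\mathbb{R}_\infty$ such that, for all $F$, $V(F)=G(F,\det F)$ if $d=2$, and $V(F)=G(F,\mathrm{adj}\,F,\det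 F)$ if $d=3$. A $\Pi_d$-invariant function $\Psi:\mathbb{R}^d\to\mathbb{R}_\infty$ is lower semicontinuous singular value polyconvex (lsc-svpc) if $F\mapsto\Psi(\nu(F))$ is lower semicontinuous polyconvex. The lsc-svpc envelope of $\Phi$ is $$\Phi^{\text{lsc-svpc}}(\hat\nu)=\sup\{\Psi(\hat\nu) : \Psi \text{ lsc-svpc},\ \Psi\le\Phi\}.$$ For $h:\mathbb{R}^{k_d}\to\mathbb{R}_\infty$, the lower semicontinuous convex envelope is $$h^{\text{lsc-c}}(x)=\sup\{g(x) : g:\mathbb{R}^{k_d}\to\mathbb{R}_\infty \text{ convex and lower semicontinuous},\ g\le h\}.$$ Both suprema are taken in $[-\infty,\infty]$, with $\sup\emptyset=-\infty$. Finally let $m:\mathbb{R}^d\to\mathbb{R}^{k_d}$ be given by $$m(\hat\nu)=(\hat\nu_1,\hat\nu_2,\hat\nu_1\hat\nu_2)\ \text{ if } d=2,\qquad m(\hat\nu)=(\hat\nu_1,\hat\nu_2,\hat\nu_3,\hat\nu_2\hat\nu_3,\hat\nu_3\hat\nu_1,\hat\nu_1\hat\nu_2,\hat\nu_1\hat\nu_2\hat\nu_3)\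 \text{ if } d=3.$$ **Proposition.** Let $\Phi:\mathbb{R}^d\to\mathbb{R}_\infty$ be $\Pi_d$-invariant, and define $h:\mathbb{R}^{k_d}\to\mathbb{R}_\infty$ by $h(m(\hat\nu))=\Phi(\hat\nu)$ for $\hat\nu\in\mathbb{R}^d$ and $h(x)=\infty$ for $x\notin m(\mathbb{R}^d)$. Then $$\Phi^{\text{lsc-svpc}}=h^{\text{lsc-c}}\circ m .$$ -/

import Mathlib

namespace SVPoly

noncomputable section

/-! Functions with values in `ℝ ∪ {∞}` are functions into `EReal` that never take the value `⊥`. -/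

/-- Convex, lower semicontinuous functions `E → ℝ ∪ {∞}`. Only weights `a, b > 0` occur in the
convexity inequality, so that no product `0 * ∞` enters. -/
structure IsLscConvex {E : Type*} [AddCommMonoid E] [Module ℝ E] [TopologicalSpace E]
    (g : E → EReal) : Prop where
  ne_bot : ∀ x, g x ≠ ⊥
  convex : ∀ x y : E, ∀ a b : ℝ, 0 < a → 0 < b → a + b = 1 →
    g (a • x + b • y) ≤ (a : EReal) * g x + (b : EReal) * g y
  lsc : LowerSemicontinuous g

/-- The lower semicontinuous convex envelope of `h`: the pointwise supremum, taken in `[-∞, ∞]`, of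
all lower semicontinuous convex functions `E → ℝ ∪ {∞}` below `h`. -/
def lscConvexEnvelope {E : Type*} [AddCommMonoid E] [Module ℝ E] [TopologicalSpace E]
    (h : E → EReal) (x : E) : EReal :=
  ⨆ (g : E → EReal) (_ : IsLscConvex g) (_ : g ≤ h), g x

/-- Lower semicontinuous polyconvexity of `V : ℝ^{d×d} → ℝ ∪ {∞}`: `V` is a lower semicontinuous
convex function of the minors, which are `(F, det F)` for `d = 2` and `(F, adj F, det F)` for
`d = 3`. Other values of `d` are not used. -/
def IsLscPolyconvex : (d : ℕ) → (Matrix (Fin d) (Fin d) ℝ → EReal) → Prop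
  | 2, V => ∃ G : Matrix (Fin 2) (Fin 2) ℝ × ℝ → EReal,
      IsLscConvex G ∧ ∀ F, V F = G (F, F.det)
  | 3, V => ∃ G : Matrix (Fin 3) (Fin 3) ℝ × Matrix (Fin 3) (Fin 3) ℝ × ℝ → EReal,
      IsLscConvex G ∧ ∀ F, V F = G (F, F.adjugate, F.det)
  | _, _ => False

/-- `ν` is a vector of signed singular values of `F`: up to order, the `|ν i|` are the singular
values of `F` (with multiplicity), and the product of the `ν i` has the sign of `det F`. -/
def IsSignedSingularValues {d : ℕ} (F : Matrix (Fin d) (Fin d) ℝ) (ν : Fin d → ℝ) : Prop :=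
  (∃ σ : Equiv.Perm (Fin d), ∀ i,
    |ν i| = (Matrix.toEuclideanLin F).singularValues ((σ i : Fin d) : ℕ)) ∧
  SignType.sign (∏ i, ν i) = SignType.sign F.det

/-- The group `Π_d` of the matrices `P diag(ε)`, with `P` a permutation matrix and `ε` a vector of
signs whose product is `1`. -/
def signedPerms (d : ℕ) : Set (Matrix (Fin d) (Fin d) ℝ) :=
  {S | ∃ (σ : Equiv.Perm (Fin d)) (ε : Fin d → ℝ), (∀ i, ε i = 1 ∨ ε i = -1) ∧ ∏ i, ε i = 1 ∧
    S = σ.permMatrix ℝ * Matrix.diagonal ε}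

/-- `Π_d`-invariance of a function on `ℝ^d`. -/
def IsPiInvariant {d : ℕ} (Φ : (Fin d → ℝ) → EReal) : Prop :=
  ∀ S ∈ signedPerms d, ∀ ν, Φ (S.mulVec ν) = Φ ν

/-- Lower semicontinuous singular value polyconvexity of a `Π_d`-invariant `Ψ : ℝ^d → ℝ ∪ {∞}`: the
corresponding isotropic function `W`, given by `W F = Ψ ν` where `ν` is any vector of signed
singular values of `F`, is lower semicontinuous polyconvex. -/
structure IsLscSvpc {d : ℕ} (Ψ : (Fin d → ℝ) → EReal) : Prop where
  ne_bot : ∀ ν, Ψ ν ≠ ⊥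
  invariant : IsPiInvariant Ψ
  polyconvex : ∃ W : Matrix (Fin d) (Fin d) ℝ → EReal,
    (∀ F ν, IsSignedSingularValues F ν → W F = Ψ ν) ∧ IsLscPolyconvex d W

/-- The lower semicontinuous singular value polyconvex envelope of `Φ`, a pointwise supremum in
`[-∞, ∞]`. -/
def lscSvpcEnvelope {d : ℕ} (Φ : (Fin d → ℝ) → EReal) (ν : Fin d → ℝ) : EReal :=
  ⨆ (Ψ : (Fin d → ℝ) → EReal) (_ : IsLscSvpc Ψ) (_ : Ψ ≤ Φ), Ψ ν

/-- The vector of minors of `ν ∈ ℝ^d`, for `d = 2` and `d = 3`. Other values of `d` are not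
used. -/
def minors : (d : ℕ) → (Fin d → ℝ) → (Fin (2 ^ d - 1) → ℝ)
  | 2, ν => ![ν 0, ν 1, ν 0 * ν 1]
  | 3, ν => ![ν 0, ν 1, ν 2, ν 1 * ν 2, ν 2 * ν 0, ν 0 * ν 1, ν 0 * ν 1 * ν 2]
  | _, _ => 0

/-- The function `h` on `ℝ^{2^d - 1}` with `h (minors d ν) = Φ ν`, and `h = ∞` off the range of
`minors d`. -/
def liftToMinors {d : ℕ} (Φ : (Fin d → ℝ) → EReal) : (Fin (2 ^ d - 1) → ℝ) → EReal :=
  Function.extend (minors d) Φ fun _ => ⊤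

theorem minors_injective {d : ℕ} (hd : d = 2 ∨ d = 3) : Function.Injective (minors d) := by
  rcases hd with rfl | rfl
  · intro ν μ h
    have h0 : ν 0 = μ 0 := congrFun h (0 : Fin 3)
    have h1 : ν 1 = μ 1 := congrFun h (1 : Fin 3)
    funext i
    fin_cases i <;> assumption
  · intro ν μ h
    have h0 : ν 0 = μ 0 := congrFun h (0 : Fin 7)
    have h1 : ν 1 = μ 1 := congrFun h (1 : Fin 7)
    have h2 : ν 2 = μ 2 := congrFun h (2 : Fin 7)
    funext i
    fin_cases i <;> assumption

/-- The lift is well defined, because a point of `ℝ^d` is determined by its minors. -/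
theorem liftToMinors_minors {d : ℕ} (hd : d = 2 ∨ d = 3) (Φ : (Fin d → ℝ) → EReal)
    (ν : Fin d → ℝ) : liftToMinors Φ (minors d ν) = Φ ν :=
  (minors_injective hd).extend_apply _ _ _

end

end SVPoly

/-!
Both inequalities compare functions on `ℝ^d` with functions of the minors.

If `Ψ ≤ Φ` is singular value polyconvex with representative `G`, the restriction of `G` to the minors
of diagonal matrices is a lower semicontinuous convex `g` with `g ∘ m = Ψ`
(`IsLscSvpc.exists_isLscConvex`). As `g` lies below the lift of `Φ`, this gives `≤`.

Conversely, let `g` be lower semicontinuous and convex with `g ∘ m ≤ Φ`. Put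
`W F = sup g (diagMinors d (Q F R))` over `Q, R ∈ SO(d)` (`rotationEnvelope`). Since the diagonal
minors of `Q F R` are linear in the minors of `F`, the function `W` is polyconvex. Since it is
invariant under rotations, the singular value decomposition with rotations
(`IsSignedSingularValues.exists_rotations`) shows that it depends only on the signed singular values
of `F`. With `Q = R = 1`, the function `Ψ ν = W (diag ν)` is at least `g ∘ m`, and what remains is
`Ψ ≤ Φ`.

This is where `Π_d` enters. The diagonal minors of `Q diag(ν) R` are an affine function of the
entrywise product of `Q` and `Rᵀ` (`diagMinors_mul_diagonal_mul`), whose values on `Π_d` are the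
minors `m (S ν)` (`affineMinors_of_mem_signedPerms`). By convexity of `g` and invariance of `Φ` it
suffices that this entrywise product lies in the convex hull of `Π_d`
(`entrywise_mul_mem_convexHull_signedPerms`). For `d = 2` this is explicit. For `d = 3`, the group
`Π_3` is the symmetry group of a regular tetrahedron, so it permutes four vertices, and its convex
hull becomes the Birkhoff polytope of doubly stochastic `4 × 4` matrices. Its sixteen inequalities
say that certain rotations have trace at least `-1`, which holds for every rotation
(`neg_one_le_trace`).
-/

namespace SVPoly

open Matrix

/-! ### Rotations and the singular value decomposition -/

theorem mem_specialOrthogonalGroup_iff_transpose_mul {d : ℕ} {Q : Matrix (Fin d) (Fin d) ℝ} :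
    Q ∈ specialOrthogonalGroup (Fin d) ℝ ↔ Qᵀ * Q = 1 ∧ Q.det = 1 := by
  rw [mem_specialOrthogonalGroup_iff, mem_orthogonalGroup_iff']

theorem transpose_mem_specialOrthogonalGroup {d : ℕ} {Q : Matrix (Fin d) (Fin d) ℝ}
    (hQ : Q ∈ specialOrthogonalGroup (Fin d) ℝ) : Qᵀ ∈ specialOrthogonalGroup (Fin d) ℝ := by
  rw [mem_specialOrthogonalGroup_iff_transpose_mul] at hQ ⊢
  exact ⟨by rw [transpose_transpose]; exact mul_eq_one_comm.1 hQ.1,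
    by rw [det_transpose]; exact hQ.2⟩

theorem adjugate_eq_transpose {d : ℕ} {Q : Matrix (Fin d) (Fin d) ℝ}
    (hQ : Q ∈ specialOrthogonalGroup (Fin d) ℝ) : Q.adjugate = Qᵀ := by
  rw [mem_specialOrthogonalGroup_iff_transpose_mul] at hQ
  have h := mul_adjugate Q
  rw [hQ.2, one_smul] at h
  calc Q.adjugate = Qᵀ * Q * Q.adjugate := by rw [hQ.1, one_mul]
    _ = Qᵀ := by rw [mul_assoc, h, mul_one]

theorem exists_perm_comp_eq_of_map_univ_eq {ι α : Type*} [Fintype ι] [DecidableEq α] {f g : ι → α}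
    (h : Finset.univ.val.map f = Finset.univ.val.map g) : ∃ σ : Equiv.Perm ι, ∀ i, f i = g (σ i) := by
  classical
  have hc (a : α) : Fintype.card {i // f i = a} = Fintype.card {i // g i = a} := by
    have := congrArg (Multiset.count a) h
    simp only [Multiset.count_map] at this
    simp only [Fintype.card_subtype]
    simpa [Finset.card, Finset.filter, eq_comm] using this
  refine ⟨(Equiv.sigmaFiberEquiv f).symm.trans ((Equiv.sigmaCongrRight fun a =>
    Fintype.equivOfCardEq (hc a)).trans (Equiv.sigmaFiberEquiv g)), fun i => ?_⟩
  exact ((Fintype.equivOfCardEq (hc (f i))) ⟨i, rfl⟩).2.symm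

theorem adjoint_comp_toEuclideanLin {d : ℕ} (F : Matrix (Fin d) (Fin d) ℝ) :
    (toEuclideanLin F).adjoint ∘ₗ toEuclideanLin F = toEuclideanLin (Fᵀ * F) := by
  rw [← toEuclideanLin_conjTranspose_eq_adjoint, conjTranspose_eq_transpose_of_trivial]
  ext v i
  simp [toLpLin_apply, mulVec_mulVec]

theorem isSignedSingularValues_diagonal {d : ℕ} (ν : Fin d → ℝ) :
    IsSignedSingularValues (diagonal ν) ν := by
  refine ⟨?_, by rw [det_diagonal]⟩
  set T := toEuclideanLin (diagonal ν) with hT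
  have hn : Module.finrank ℝ (EuclideanSpace ℝ (Fin d)) = d := by simp
  have h1 := T.isSymmetric_adjoint_comp_self.roots_charpoly_eq_eigenvalues hn
  have h2 : (T.adjoint ∘ₗ T).charpoly.roots = Finset.univ.val.map fun i => ν i ^ 2 := by
    rw [hT, adjoint_comp_toEuclideanLin, toEuclideanLin_eq_toLin_orthonormal, charpoly_toLin,
      diagonal_transpose, diagonal_mul_diagonal, charpoly_diagonal, Polynomial.roots_prod _ _
        (Finset.prod_ne_zero_iff.2 fun i _ => Polynomial.X_sub_C_ne_zero _)]
    simp only [Polynomial.roots_X_sub_C, Multiset.bind_singleton, sq]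
  obtain ⟨σ, hσ⟩ := exists_perm_comp_eq_of_map_univ_eq (h2.symm.trans h1)
  refine ⟨σ, fun i => ?_⟩
  have h3 : ν i ^ 2 = T.singularValues (σ i : Fin d) ^ 2 := by
    rw [T.sq_singularValues_fin hn]; exact hσ i
  rw [← Real.sqrt_sq_eq_abs, h3, Real.sqrt_sq (T.singularValues_nonneg _)]

/-- A singular value decomposition with prescribed signs: only the absolute values of the `ν i` are
tied to `F`, because the signs can be moved into the columns of the orthogonal factor `U`. -/
theorem exists_orthogonal_mul_diagonal {d : ℕ} {F : Matrix (Fin d) (Fin d) ℝ} {ν : Fin d → ℝ}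
    (h : ∃ σ : Equiv.Perm (Fin d), ∀ i,
      |ν i| = (toEuclideanLin F).singularValues ((σ i : Fin d) : ℕ)) :
    ∃ U V : Matrix (Fin d) (Fin d) ℝ, Uᵀ * U = 1 ∧ Vᵀ * V = 1 ∧ F = U * diagonal ν * Vᵀ := by
  obtain ⟨σ, hσ⟩ := h
  set T := toEuclideanLin F with hT
  have hn : Module.finrank ℝ (EuclideanSpace ℝ (Fin d)) = d := by simp
  let v : OrthonormalBasis (Fin d) ℝ (EuclideanSpace ℝ (Fin d)) :=
    (T.isSymmetric_adjoint_comp_self.eigenvectorBasis hn).reindex σ.symm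
  have hv (i) : T.adjoint (T (v i)) = (ν i ^ 2) • v i := by
    have := T.isSymmetric_adjoint_comp_self.apply_eigenvectorBasis hn (σ i)
    rw [← T.sq_singularValues_fin hn, ← hσ, sq_abs] at this
    rw [← LinearMap.comp_apply]
    simpa only [v, OrthonormalBasis.reindex_apply, Equiv.symm_symm,
      RCLike.ofReal_real_eq_id, id_eq] using this
  have hin (i j) : inner ℝ (T (v i)) (T (v j)) = if i = j then ν i ^ 2 else 0 := by
    rw [← LinearMap.adjoint_inner_right, hv, inner_smul_right,
      orthonormal_iff_ite.1 v.orthonormal i j]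
    split_ifs with hij
    · rw [hij, mul_one]
    · rw [mul_zero]
  -- the left singular vectors for `ν i ≠ 0`; the others are
  -- supplied by extending to an orthonormal basis
  let w : Fin d → EuclideanSpace ℝ (Fin d) := fun i => (ν i)⁻¹ • T (v i)
  have hw : Orthonormal ℝ ({i | ν i ≠ 0}.domRestrict w) := by
    rw [orthonormal_iff_ite]
    rintro ⟨i, hi⟩ ⟨j, hj⟩
    simp only [Set.mem_ofPred_eq] at hi hj
    simp only [Set.domRestrict_apply, w, inner_smul_left, inner_smul_right, hin, Subtype.mk.injEq]
    split_ifs with hij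
    · subst hij; simp; field_simp
    · simp
  obtain ⟨u, hu⟩ := hw.exists_orthonormalBasis_extension_of_card_eq (by simp)
  have hTv (i) : T (v i) = ν i • u i := by
    by_cases hi : ν i = 0
    · have := hin i i
      rw [if_pos rfl, hi, zero_pow two_ne_zero, inner_self_eq_zero] at this
      rw [this, hi, zero_smul]
    · rw [hu i hi, smul_smul, mul_inv_cancel₀ hi, one_smul]
  have horth (b : OrthonormalBasis (Fin d) ℝ (EuclideanSpace ℝ (Fin d))) :
      (of fun i j => b j i)ᵀ * (of fun i j => b j i) = (1 : Matrix (Fin d) (Fin d) ℝ) := by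
    ext i j
    have := orthonormal_iff_ite.1 b.orthonormal i j
    simp only [mul_apply, transpose_apply, of_apply, one_apply]
    rw [← this, PiLp.inner_apply]
    exact Finset.sum_congr rfl fun k _ => by simp [mul_comm]
  refine ⟨of fun i j => u j i, of fun i j => v j i, horth u, horth v, ?_⟩
  have hFV : F * (of fun i j => v j i) = (of fun i j => u j i) * diagonal ν := by
    ext i j
    have := congrArg (fun x : EuclideanSpace ℝ (Fin d) => x i) (hTv j)
    simp only [hT, toLpLin_apply, mulVec, dotProduct, PiLp.smul_apply, smul_eq_mul] at this
    rw [mul_diagonal, mul_apply, of_apply, mul_comm, ← this]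
    rfl
  rw [← hFV, mul_assoc, mul_eq_one_comm.1 (horth v), mul_one]

/-- The singular value decomposition with rotations: if `ν` is a vector of signed singular values
of `F`, then `F = Q diag(ν) R` with `Q, R ∈ SO(d)`. -/
theorem IsSignedSingularValues.exists_rotations {d : ℕ} [NeZero d]
    {F : Matrix (Fin d) (Fin d) ℝ} {ν : Fin d → ℝ} (h : IsSignedSingularValues F ν) :
    ∃ Q ∈ specialOrthogonalGroup (Fin d) ℝ, ∃ R ∈ specialOrthogonalGroup (Fin d) ℝ,
      F = Q * diagonal ν * R := by
  obtain ⟨U, V, hU, hV, hF⟩ := exists_orthogonal_mul_diagonal h.1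
  -- reflection in the coordinate `k`
  let J (k : Fin d) : Matrix (Fin d) (Fin d) ℝ := diagonal (Function.update 1 k (-1))
  have hJdet (k) : (J k).det = -1 := by
    simp [J, det_diagonal, Finset.prod_update_of_mem]
  have hJt (k) : (J k)ᵀ = J k := diagonal_transpose _
  have hJJ (k) : J k * J k = 1 := by
    simp only [J, diagonal_mul_diagonal]
    rw [← diagonal_one]
    congr 1; funext i
    by_cases hi : i = k
    · subst hi; simp
    · simp [hi]
  have hcomm (k) : J k * diagonal ν = diagonal ν * J k := by
    simp only [J, diagonal_mul_diagonal, mul_comm]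
  have horth (k) {A : Matrix (Fin d) (Fin d) ℝ} (hA : Aᵀ * A = 1) : (A * J k)ᵀ * (A * J k) = 1 := by
    rw [transpose_mul, hJt, mul_assoc, ← mul_assoc Aᵀ, hA, one_mul, hJJ]
  have hdet1 {A : Matrix (Fin d) (Fin d) ℝ} (hA : Aᵀ * A = 1) : A.det = 1 ∨ A.det = -1 := by
    have := congrArg det hA
    rw [det_mul, det_transpose, det_one] at this
    exact mul_self_eq_one_iff.1 this
  have key : ∃ U V : Matrix (Fin d) (Fin d) ℝ, Uᵀ * U = 1 ∧ Vᵀ * V = 1 ∧ U.det = V.det ∧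
      F = U * diagonal ν * Vᵀ := by
    by_cases huv : U.det = V.det
    · exact ⟨U, V, hU, hV, huv, hF⟩
    have hneg : U.det = -V.det := by
      rcases hdet1 hU with h1 | h1 <;> rcases hdet1 hV with h2 | h2 <;> rw [h1, h2] at huv ⊢ <;>
        simp at huv ⊢
    -- the determinants have opposite signs, so the sign condition forces `det F = 0`
    have hprod : ∏ i, ν i = 0 := by
      have hs := h.2
      have hV1 : V.det * V.det = 1 := by rcases hdet1 hV with h2 | h2 <;> rw [h2] <;> norm_num
      have : F.det = -∏ i, ν i := by
        rw [hF, det_mul, det_mul, det_transpose, det_diagonal, hneg]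
        linear_combination (-∏ i, ν i) * hV1
      rw [this, Left.sign_neg] at hs
      exact sign_eq_zero_iff.1 (SignType.self_eq_neg_iff.1 hs)
    -- flipping the `k`-th column of `U` changes `det U` but not `U diag(ν)`
    obtain ⟨k, -, hk⟩ := Finset.prod_eq_zero_iff.1 hprod
    refine ⟨U * J k, V, horth k hU, hV, by rw [det_mul, hJdet, hneg]; ring, ?_⟩
    have : J k * diagonal ν = diagonal ν := by
      simp only [J, diagonal_mul_diagonal]
      congr 1; funext i
      by_cases hi : i = k
      · subst hi; simp [hk]
      · simp [hi]
    rw [mul_assoc U, this, hF]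
  obtain ⟨U, V, hU, hV, huv, hF⟩ := key
  rcases hdet1 hU with h1 | h1
  · exact ⟨U, mem_specialOrthogonalGroup_iff_transpose_mul.2 ⟨hU, h1⟩, Vᵀ,
      transpose_mem_specialOrthogonalGroup
        (mem_specialOrthogonalGroup_iff_transpose_mul.2 ⟨hV, huv ▸ h1⟩), hF⟩
  -- both determinants are `-1`: a reflection commutes with `diag(ν)`,
  -- so it can be absorbed by `U` and `V` together
  · refine ⟨U * J 0, mem_specialOrthogonalGroup_iff_transpose_mul.2 ⟨horth 0 hU, ?_⟩, (V * J 0)ᵀ,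
      transpose_mem_specialOrthogonalGroup
        (mem_specialOrthogonalGroup_iff_transpose_mul.2 ⟨horth 0 hV, ?_⟩), ?_⟩
    · rw [det_mul, hJdet, h1]; norm_num
    · rw [det_mul, hJdet, ← huv, h1]; norm_num
    · rw [transpose_mul, hJt, mul_assoc U, hcomm, mul_assoc, mul_assoc, ← mul_assoc (J 0), hJJ,
        one_mul, ← mul_assoc, hF]

/-! ### Entrywise products of rotations -/

/-- The trace `t` of a rotation is at least `-1`: as `adj U = Uᵀ`, the product `(3 - t) (1 + t)` is a
sum of squares of entries of `U - Uᵀ`. -/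
theorem neg_one_le_trace {U : Matrix (Fin 3) (Fin 3) ℝ}
    (hU : U ∈ specialOrthogonalGroup (Fin 3) ℝ) : -1 ≤ U.trace := by
  have hadj := adjugate_eq_transpose hU
  have hUU := (mem_specialOrthogonalGroup_iff_transpose_mul.1 hU).1
  have e (i) := congrFun (congrFun hUU i) i
  have a (i) := congrFun (congrFun hadj i) i
  have e0 := e 0
  have e1 := e 1
  have e2 := e 2
  have a0 := a 0
  have a1 := a 1
  have a2 := a 2
  simp [mul_apply, Fin.sum_univ_three, adjugate_fin_three] at e0 e1 e2 a0 a1 a2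
  rw [trace_fin_three]
  have key : (3 - (U 0 0 + U 1 1 + U 2 2)) * (1 + (U 0 0 + U 1 1 + U 2 2)) =
      (U 0 1 - U 1 0) ^ 2 + (U 0 2 - U 2 0) ^ 2 + (U 1 2 - U 2 1) ^ 2 := by
    linear_combination -2 * a0 - 2 * a1 - 2 * a2 - e0 - e1 - e2
  by_contra hlt
  have h3 := mul_pos (show 0 < 3 - (U 0 0 + U 1 1 + U 2 2) by linarith)
    (show 0 < -(1 + (U 0 0 + U 1 1 + U 2 2)) by linarith)
  nlinarith [sq_nonneg (U 0 1 - U 1 0), sq_nonneg (U 0 2 - U 2 0), sq_nonneg (U 1 2 - U 2 1)]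

/-- The four vertices of a regular tetrahedron centred at the origin. -/
def tetrahedron : Fin 4 → Fin 3 → ℤ :=
  ![![1, 1, 1], ![1, -1, -1], ![-1, 1, -1], ![-1, -1, 1]]

/-- A permutation of the vertices of the tetrahedron is induced by a unique linear map, and this map
is a signed permutation matrix with product of signs one. The factor `4` comes from
`∑ k, v k (v k)ᵀ = 4` for the vertices `v k`. -/
theorem sum_tetrahedron_mul_perm (π : Equiv.Perm (Fin 4)) :
    ∃ (σ : Equiv.Perm (Fin 3)) (ε : Fin 3 → ℤˣ), ∏ i, ε i = 1 ∧
      ∀ i j, ∑ k, tetrahedron k i * tetrahedron (π k) j =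
        if σ i = j then 4 * (ε j : ℤ) else 0 := by
  revert π
  decide +kernel

theorem entrywise_mul_mem_convexHull_signedPerms_two {Q R : Matrix (Fin 2) (Fin 2) ℝ}
    (hQ : Q ∈ specialOrthogonalGroup (Fin 2) ℝ) (hR : R ∈ specialOrthogonalGroup (Fin 2) ℝ) :
    (of fun i j => Q i j * R j i) ∈ convexHull ℝ (signedPerms 2) := by
  obtain ⟨q1, q2, q3⟩ := mem_specialOrthogonalGroup_fin_two_iff.1 hQ
  obtain ⟨r1, r2, r3⟩ := mem_specialOrthogonalGroup_fin_two_iff.1 hR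
  set x := Q 0 0 * R 0 0 with hx
  set y := Q 0 1 * R 1 0 with hy
  have hX : (of fun i j => Q i j * R j i) = !![x, y; y, x] := by
    ext i j
    fin_cases i <;> fin_cases j <;> simp [x, y]
    · rw [r2, q2]; ring
    · rw [← q1, ← r1]
  have hr : R 1 0 ^ 2 = R 0 1 ^ 2 := by rw [r2]; ring
  -- `p` and `q` parametrize the square `|x| + |y| ≤ 1` by the unit square
  set p := (1 + x + y) / 2 with hp
  set q := (1 + x - y) / 2 with hq
  have hp0 : 0 ≤ p := by
    nlinarith [sq_nonneg (Q 0 0 + R 0 0), sq_nonneg (Q 0 1 + R 1 0)]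
  have hp1 : 0 ≤ 1 - p := by
    nlinarith [sq_nonneg (Q 0 0 - R 0 0), sq_nonneg (Q 0 1 - R 1 0)]
  have hq0 : 0 ≤ q := by
    nlinarith [sq_nonneg (Q 0 0 + R 0 0), sq_nonneg (Q 0 1 - R 1 0)]
  have hq1 : 0 ≤ 1 - q := by
    nlinarith [sq_nonneg (Q 0 0 - R 0 0), sq_nonneg (Q 0 1 + R 1 0)]
  have hmem (σ : Equiv.Perm (Fin 2)) (e : ℝ) (he : e = 1 ∨ e = -1) :
      σ.permMatrix ℝ * diagonal (fun _ => e) ∈ signedPerms 2 := by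
    refine ⟨σ, fun _ => e, fun _ => he, ?_, rfl⟩
    rcases he with rfl | rfl <;> simp
  rw [hX]
  refine mem_convexHull_of_exists_fintype
    ![p * q, (1 - p) * (1 - q), p * (1 - q), (1 - p) * q]
    ![(1 : Equiv.Perm (Fin 2)).permMatrix ℝ * diagonal (fun _ => 1),
      (1 : Equiv.Perm (Fin 2)).permMatrix ℝ * diagonal (fun _ => -1),
      (Equiv.swap (0 : Fin 2) 1).permMatrix ℝ * diagonal (fun _ => 1),
      (Equiv.swap (0 : Fin 2) 1).permMatrix ℝ * diagonal (fun _ => -1)] ?_ ?_ ?_ ?_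
  · intro i
    fin_cases i <;> simp <;> positivity
  · simp [Fin.sum_univ_four]; ring
  · intro i
    fin_cases i
    · exact hmem _ _ (Or.inl rfl)
    · exact hmem _ _ (Or.inr rfl)
    · exact hmem _ _ (Or.inl rfl)
    · exact hmem _ _ (Or.inr rfl)
  · ext i j
    fin_cases i <;> fin_cases j <;>
      simp [Fin.sum_univ_four, PEquiv.toMatrix_apply, hp, hq] <;> ring

/-- Through the vertices of the tetrahedron, the convex hull of `signedPerms 3` is the Birkhoff
polytope of doubly stochastic `4 × 4` matrices. Under this identification the entries of the matrix
that corresponds to the entrywise product are `(1 + trace) / 4` for traces of rotations, hence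
nonnegative. -/
theorem entrywise_mul_mem_convexHull_signedPerms_three {Q R : Matrix (Fin 3) (Fin 3) ℝ}
    (hQ : Q ∈ specialOrthogonalGroup (Fin 3) ℝ) (hR : R ∈ specialOrthogonalGroup (Fin 3) ℝ) :
    (of fun i j => Q i j * R j i) ∈ convexHull ℝ (signedPerms 3) := by
  set X : Matrix (Fin 3) (Fin 3) ℝ := of fun i j => Q i j * R j i with hX
  let A : Matrix (Fin 4) (Fin 3) ℝ := of fun k i => (tetrahedron k i : ℝ)
  -- `T` sends the matrix of a permutation of the vertices to the linear map that induces it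
  let T : Matrix (Fin 4) (Fin 4) ℝ →ₗ[ℝ] Matrix (Fin 3) (Fin 3) ℝ :=
    { toFun := fun B => (1 / 4 : ℝ) • (Aᵀ * B * A)
      map_add' := fun B C => by simp [Matrix.mul_add, Matrix.add_mul]
      map_smul' := fun c B => by simp [smul_smul, mul_comm] }
  have hT (B : Matrix (Fin 4) (Fin 4) ℝ) (i j : Fin 3) :
      T B i j = 1 / 4 * ∑ l, (∑ k, A k i * B k l) * A l j := by
    simp [T, mul_apply]
  have hTperm (π : Equiv.Perm (Fin 4)) : T (π.permMatrix ℝ) ∈ signedPerms 3 := by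
    obtain ⟨σ, ε, hε, h⟩ := sum_tetrahedron_mul_perm π
    refine ⟨σ, fun i => (ε i : ℤ), fun i => ?_, ?_, ?_⟩
    · rcases Int.units_eq_one_or (ε i) with h | h <;> simp [h]
    · have := congrArg (fun u : ℤˣ => ((u : ℤ) : ℝ)) hε
      simpa using this
    · ext i j
      have h' := congrArg (fun z : ℤ => (z : ℝ)) (h i j)
      push_cast at h'
      have e1 : T (π.permMatrix ℝ) i j =
          1 / 4 * ∑ k, (tetrahedron k i : ℝ) * (tetrahedron (π k) j : ℝ) := by
        simp only [hT, Finset.sum_mul]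
        rw [Finset.sum_comm]
        simp [A, PEquiv.toMatrix_apply]
      rw [e1, h', mul_diagonal]
      by_cases hij : σ i = j <;> simp [hij, PEquiv.toMatrix_apply]
  have hTX : T (of fun k l => 1 / 4 * (1 + ∑ i, ∑ j, A k i * X i j * A l j)) = X := by
    ext i j
    simp only [hT, Fin.sum_univ_four, Fin.sum_univ_three, of_apply]
    fin_cases i <;> fin_cases j <;> simp [A, tetrahedron] <;> ring
  have hdet (k : Fin 4) : diagonal (A k) ∈ specialOrthogonalGroup (Fin 3) ℝ := by
    rw [mem_specialOrthogonalGroup_iff_transpose_mul, diagonal_transpose, diagonal_mul_diagonal,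
      det_diagonal, ← diagonal_one]
    refine ⟨congrArg diagonal (funext fun i => ?_), ?_⟩
    · fin_cases k <;> fin_cases i <;> simp [A, tetrahedron]
    · fin_cases k <;> simp [A, tetrahedron, Fin.prod_univ_three]
  have hB : (of fun k l => 1 / 4 * (1 + ∑ i, ∑ j, A k i * X i j * A l j)) ∈
      doublyStochastic ℝ (Fin 4) := by
    rw [mem_doublyStochastic]
    refine ⟨fun k l => ?_, ?_, ?_⟩
    · have h := neg_one_le_trace (mul_mem (mul_mem (mul_mem (hdet k) hQ) (hdet l)) hR)
      have e : (diagonal (A k) * Q * diagonal (A l) * R).trace =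
          ∑ i, ∑ j, A k i * X i j * A l j := by
        refine Finset.sum_congr rfl fun i _ => ?_
        rw [diag_apply, mul_apply]
        refine Finset.sum_congr rfl fun j _ => ?_
        rw [mul_diagonal, diagonal_mul, hX, of_apply]
        ring
      rw [e] at h
      rw [of_apply]
      linarith
    · ext k
      simp [mulVec, dotProduct, Fin.sum_univ_four, Fin.sum_univ_three, A, tetrahedron]
      ring
    · ext l
      simp [vecMul, dotProduct, Fin.sum_univ_four, Fin.sum_univ_three, A, tetrahedron]
      ring
  rw [← SetLike.mem_coe, doublyStochastic_eq_convexHull_permMatrix] at hB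
  rw [← hTX]
  refine convexHull_min ?_ ((convex_convexHull ℝ (signedPerms 3)).linear_preimage T) hB
  rintro _ ⟨π, rfl⟩
  exact subset_convexHull ℝ _ (hTperm π)

/-! ### Lower semicontinuous convex functions -/

theorem IsLscConvex.comp {E F : Type*} [AddCommMonoid E] [Module ℝ E] [TopologicalSpace E]
    [AddCommMonoid F] [Module ℝ F] [TopologicalSpace F] {g : F → EReal} (hg : IsLscConvex g)
    {A : E → F} (hA : Continuous A)
    (hA' : ∀ x y, ∀ a b : ℝ, a + b = 1 → A (a • x + b • y) = a • A x + b • A y) :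
    IsLscConvex fun x => g (A x) where
  ne_bot x := hg.ne_bot _
  convex x y a b ha hb hab := by
    rw [hA' x y a b hab]
    exact hg.convex _ _ _ _ ha hb hab
  lsc := LowerSemicontinuous.comp hg.lsc hA

theorem IsLscConvex.iSup {ι E : Type*} [Nonempty ι] [AddCommMonoid E] [Module ℝ E]
    [TopologicalSpace E] {g : ι → E → EReal} (hg : ∀ i, IsLscConvex (g i)) :
    IsLscConvex fun x => ⨆ i, g i x where
  ne_bot x h := (hg (Classical.arbitrary ι)).ne_bot x (iSup_eq_bot.1 h _)
  convex x y a b ha hb hab := by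
    refine iSup_le fun i => ((hg i).convex x y a b ha hb hab).trans ?_
    have ha' : (0 : EReal) ≤ a := EReal.coe_nonneg.2 ha.le
    have hb' : (0 : EReal) ≤ b := EReal.coe_nonneg.2 hb.le
    exact add_le_add (mul_le_mul_of_nonneg_left (le_iSup (fun i => g i x) i) ha')
      (mul_le_mul_of_nonneg_left (le_iSup (fun i => g i y) i) hb')
  lsc := lowerSemicontinuous_iSup fun i => (hg i).lsc

theorem IsLscConvex.convex_sublevel {E : Type*} [AddCommMonoid E] [Module ℝ E]
    [TopologicalSpace E] {g : E → EReal} (hg : IsLscConvex g) (c : EReal) :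
    Convex ℝ {x | g x ≤ c} := by
  rw [convex_iff_forall_pos]
  intro x hx y hy a b ha hb hab
  have ha' : (0 : EReal) ≤ a := EReal.coe_nonneg.2 ha.le
  have hb' : (0 : EReal) ≤ b := EReal.coe_nonneg.2 hb.le
  calc g (a • x + b • y) ≤ a * g x + b * g y := hg.convex x y a b ha hb hab
    _ ≤ a * c + b * c :=
      add_le_add (mul_le_mul_of_nonneg_left hx ha') (mul_le_mul_of_nonneg_left hy hb')
    _ = c := by
      rw [← EReal.right_distrib_of_nonneg ha' hb', ← EReal.coe_add, hab, EReal.coe_one, one_mul]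

/-! ### Minors of rotated diagonal matrices -/

/-- The minors of `F` that extend `minors d` from diagonal matrices to all matrices: the diagonal
entries of `F` and, for `d = 3`, of `adj F`, followed by the determinant. Other values of `d` are not
used. -/
def diagMinors : (d : ℕ) → Matrix (Fin d) (Fin d) ℝ → (Fin (2 ^ d - 1) → ℝ)
  | 2, F => ![F 0 0, F 1 1, F.det]
  | 3, F => ![F 0 0, F 1 1, F 2 2, F.adjugate 0 0, F.adjugate 1 1, F.adjugate 2 2, F.det]
  | _, _ => 0

/-- For fixed `ν`, the affine function of `X` that agrees with `minors d (X ν)` on `signedPerms d`: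
`X` acts linearly on `ν` and, for `d = 3`, on the vector of cofactors of `ν`. Other values of `d`
are not used. -/
def affineMinors : (d : ℕ) → (Fin d → ℝ) → Matrix (Fin d) (Fin d) ℝ → (Fin (2 ^ d - 1) → ℝ)
  | 2, ν, X => ![(X *ᵥ ν) 0, (X *ᵥ ν) 1, ν 0 * ν 1]
  | 3, ν, X =>
    let c := ![ν 1 * ν 2, ν 2 * ν 0, ν 0 * ν 1]
    ![(X *ᵥ ν) 0, (X *ᵥ ν) 1, (X *ᵥ ν) 2, (X *ᵥ c) 0, (X *ᵥ c) 1, (X *ᵥ c) 2, ν 0 * ν 1 * ν 2]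
  | _, _, _ => 0

theorem diagMinors_diagonal {d : ℕ} (hd : d = 2 ∨ d = 3) (ν : Fin d → ℝ) :
    diagMinors d (diagonal ν) = minors d ν := by
  rcases hd with rfl | rfl
  · simp [diagMinors, minors]
  · simp only [diagMinors, minors, det_diagonal, adjugate_diagonal, diagonal_apply_eq,
      Fin.prod_univ_three]
    have e0 : ∏ j ∈ Finset.univ.erase (0 : Fin 3), ν j = ν 1 * ν 2 := by
      rw [show Finset.univ.erase (0 : Fin 3) = {1, 2} by decide]; simp
    have e1 : ∏ j ∈ Finset.univ.erase (1 : Fin 3), ν j = ν 2 * ν 0 := by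
      rw [show Finset.univ.erase (1 : Fin 3) = {2, 0} by decide]; simp
    have e2 : ∏ j ∈ Finset.univ.erase (2 : Fin 3), ν j = ν 0 * ν 1 := by
      rw [show Finset.univ.erase (2 : Fin 3) = {0, 1} by decide]; simp
    rw [e0, e1, e2]

theorem affineMinors_add_smul {d : ℕ} (hd : d = 2 ∨ d = 3) (ν : Fin d → ℝ)
    (X Y : Matrix (Fin d) (Fin d) ℝ) (a b : ℝ) (hab : a + b = 1) :
    affineMinors d ν (a • X + b • Y) = a • affineMinors d ν X + b • affineMinors d ν Y := by
  rcases hd with rfl | rfl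
  · simp only [affineMinors, add_mulVec, smul_mulVec]
    simp [← add_mul, hab]
  · simp only [affineMinors, add_mulVec, smul_mulVec]
    simp [← add_mul, hab]

/-- On `signedPerms d`, the vector of cofactors of `S ν` is `S` applied to the vector of cofactors of
`ν`, and `S` preserves the product of the entries. -/
theorem affineMinors_of_mem_signedPerms {d : ℕ} (hd : d = 2 ∨ d = 3) (ν : Fin d → ℝ)
    {S : Matrix (Fin d) (Fin d) ℝ} (hS : S ∈ signedPerms d) :
    affineMinors d ν S = minors d (S *ᵥ ν) := by
  obtain ⟨σ, ε, hε, hprod, rfl⟩ := hS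
  have hmul (μ : Fin d → ℝ) (i : Fin d) :
      ((σ.permMatrix ℝ * diagonal ε) *ᵥ μ) i = ε (σ i) * μ (σ i) := by
    rw [← mulVec_mulVec, PEquiv.toMatrix_toPEquiv_mulVec, Function.comp_apply, mulVec_diagonal]
  have hsq (i) : ε i * ε i = 1 := by rcases hε i with h | h <;> simp [h]
  rcases hd with rfl | rfl
  · simp only [affineMinors, minors, hmul]
    rw [Fin.prod_univ_two] at hprod
    have hσ : (σ 0 = 0 ∧ σ 1 = 1) ∨ (σ 0 = 1 ∧ σ 1 = 0) := by
      clear hmul; revert σ; decide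
    have : ν 0 * ν 1 = ε (σ 0) * ν (σ 0) * (ε (σ 1) * ν (σ 1)) := by
      rcases hσ with ⟨h0, h1⟩ | ⟨h0, h1⟩ <;> rw [h0, h1] <;>
        linear_combination (-ν 0 * ν 1) * hprod
    rw [this]
  · simp only [affineMinors, minors, hmul]
    rw [Fin.prod_univ_three] at hprod
    -- a sign vector with product one is its own vector of cofactors
    have c0 : ε 1 * ε 2 = ε 0 := by linear_combination ε 0 * hprod - ε 1 * ε 2 * hsq 0
    have c1 : ε 2 * ε 0 = ε 1 := by linear_combination ε 1 * hprod - ε 2 * ε 0 * hsq 1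
    have c2 : ε 0 * ε 1 = ε 2 := by linear_combination ε 2 * hprod - ε 0 * ε 1 * hsq 2
    have hσ : (σ 0 = 0 ∧ σ 1 = 1 ∧ σ 2 = 2) ∨ (σ 0 = 0 ∧ σ 1 = 2 ∧ σ 2 = 1) ∨
        (σ 0 = 1 ∧ σ 1 = 0 ∧ σ 2 = 2) ∨ (σ 0 = 1 ∧ σ 1 = 2 ∧ σ 2 = 0) ∨
        (σ 0 = 2 ∧ σ 1 = 0 ∧ σ 2 = 1) ∨ (σ 0 = 2 ∧ σ 1 = 1 ∧ σ 2 = 0) := by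
      clear hmul; revert σ; decide
    rcases hσ with ⟨h0, h1, h2⟩ | ⟨h0, h1, h2⟩ | ⟨h0, h1, h2⟩ | ⟨h0, h1, h2⟩ | ⟨h0, h1, h2⟩ |
      ⟨h0, h1, h2⟩ <;> rw [h0, h1, h2] <;> ext i <;> fin_cases i <;> simp <;>
      first
      | linear_combination (-ν 0 * ν 1 * ν 2) * hprod
      | linear_combination (-ν 1 * ν 2) * c0
      | linear_combination (-ν 2 * ν 0) * c1
      | linear_combination (-ν 0 * ν 1) * c2

/-- The diagonal minors of `Q diag(ν) R` depend on the rotations `Q` and `R` only through the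
entrywise product of `Q` and the transpose of `R`, because `adj` reverses products and
`adj Q = Qᵀ`. -/
theorem diagMinors_mul_diagonal_mul {d : ℕ} (hd : d = 2 ∨ d = 3) (ν : Fin d → ℝ)
    {Q R : Matrix (Fin d) (Fin d) ℝ} (hQ : Q ∈ specialOrthogonalGroup (Fin d) ℝ)
    (hR : R ∈ specialOrthogonalGroup (Fin d) ℝ) :
    diagMinors d (Q * diagonal ν * R) = affineMinors d ν (of fun i j => Q i j * R j i) := by
  have hdet : (Q * diagonal ν * R).det = (diagonal ν).det := by
    rw [det_mul, det_mul, (mem_specialOrthogonalGroup_iff.1 hQ).2,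
      (mem_specialOrthogonalGroup_iff.1 hR).2, one_mul, mul_one]
  have hdiag (μ : Fin d → ℝ) (i : Fin d) :
      (Q * diagonal μ * R) i i = ((of fun i j => Q i j * R j i) *ᵥ μ) i := by
    simp only [mul_apply, mulVec, dotProduct, of_apply, diagonal_apply]
    exact Finset.sum_congr rfl fun j _ => by simp; ring
  have hm := diagMinors_diagonal hd ν
  rcases hd with rfl | rfl
  · simp only [diagMinors, affineMinors, hdiag, hdet]
    simp
  · have hadj (i) : (Q * diagonal ν * R).adjugate i i =
        ((of fun i j => Q i j * R j i) *ᵥ ![ν 1 * ν 2, ν 2 * ν 0, ν 0 * ν 1]) i := by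
      have hc : (diagonal ν).adjugate = diagonal ![ν 1 * ν 2, ν 2 * ν 0, ν 0 * ν 1] := by
        have h3 := congrFun hm (3 : Fin 7)
        have h4 := congrFun hm (4 : Fin 7)
        have h5 := congrFun hm (5 : Fin 7)
        simp [diagMinors, minors, adjugate_diagonal] at h3 h4 h5
        rw [adjugate_diagonal]
        congr 1
        ext i
        fin_cases i
        · exact h3
        · exact h4
        · exact h5
      rw [← hdiag, adjugate_mul_distrib, adjugate_mul_distrib, adjugate_eq_transpose hQ,
        adjugate_eq_transpose hR, hc, ← transpose_apply (Q * _ * R), transpose_mul, transpose_mul,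
        diagonal_transpose]
    simp only [diagMinors, affineMinors, hdiag, hdet, hadj]
    simp [Fin.prod_univ_three]

theorem entrywise_mul_mem_convexHull_signedPerms {d : ℕ} (hd : d = 2 ∨ d = 3)
    {Q R : Matrix (Fin d) (Fin d) ℝ} (hQ : Q ∈ specialOrthogonalGroup (Fin d) ℝ)
    (hR : R ∈ specialOrthogonalGroup (Fin d) ℝ) :
    (of fun i j => Q i j * R j i) ∈ convexHull ℝ (signedPerms d) := by
  rcases hd with rfl | rfl
  · exact entrywise_mul_mem_convexHull_signedPerms_two hQ hR
  · exact entrywise_mul_mem_convexHull_signedPerms_three hQ hR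

/-! ### The rotation envelope -/

/-- The smallest function above `F ↦ g (diagMinors d F)` that is invariant under rotations from the
left and from the right, as a supremum over pairs of rotations. -/
noncomputable def rotationEnvelope {d : ℕ} (g : (Fin (2 ^ d - 1) → ℝ) → EReal)
    (F : Matrix (Fin d) (Fin d) ℝ) : EReal :=
  ⨆ p : specialOrthogonalGroup (Fin d) ℝ × specialOrthogonalGroup (Fin d) ℝ,
    g (diagMinors d (p.1 * F * p.2))

theorem rotationEnvelope_mul_mul_le {d : ℕ} (g : (Fin (2 ^ d - 1) → ℝ) → EReal)
    (F : Matrix (Fin d) (Fin d) ℝ) {Q R : Matrix (Fin d) (Fin d) ℝ}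
    (hQ : Q ∈ specialOrthogonalGroup (Fin d) ℝ) (hR : R ∈ specialOrthogonalGroup (Fin d) ℝ) :
    rotationEnvelope g (Q * F * R) ≤ rotationEnvelope g F := by
  refine iSup_le fun p => ?_
  refine le_iSup_of_le (p.1 * ⟨Q, hQ⟩, ⟨R, hR⟩ * p.2) (le_of_eq ?_)
  simp only [Submonoid.coe_mul, mul_assoc]

theorem rotationEnvelope_mul_mul {d : ℕ} (g : (Fin (2 ^ d - 1) → ℝ) → EReal)
    (F : Matrix (Fin d) (Fin d) ℝ) {Q R : Matrix (Fin d) (Fin d) ℝ}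
    (hQ : Q ∈ specialOrthogonalGroup (Fin d) ℝ) (hR : R ∈ specialOrthogonalGroup (Fin d) ℝ) :
    rotationEnvelope g (Q * F * R) = rotationEnvelope g F := by
  refine le_antisymm (rotationEnvelope_mul_mul_le g F hQ hR) ?_
  have h := rotationEnvelope_mul_mul_le g (Q * F * R) (transpose_mem_specialOrthogonalGroup hQ)
    (transpose_mem_specialOrthogonalGroup hR)
  have e : Qᵀ * (Q * F * R) * Rᵀ = F := by
    rw [mem_specialOrthogonalGroup_iff_transpose_mul] at hQ hR
    calc Qᵀ * (Q * F * R) * Rᵀ = (Qᵀ * Q) * F * (R * Rᵀ) := by simp only [mul_assoc]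
      _ = F := by rw [hQ.1, mul_eq_one_comm.1 hR.1, one_mul, mul_one]
  rwa [e] at h

/-- Each `diagMinors d (Q F R)` is a linear function of the minors of `F`, so that `rotationEnvelope g`
is a supremum of lower semicontinuous convex functions of the minors. -/
theorem isLscPolyconvex_rotationEnvelope {d : ℕ} (hd : d = 2 ∨ d = 3)
    {g : (Fin (2 ^ d - 1) → ℝ) → EReal} (hg : IsLscConvex g) :
    IsLscPolyconvex d (rotationEnvelope g) := by
  have hdet (F : Matrix (Fin d) (Fin d) ℝ)
      (p : specialOrthogonalGroup (Fin d) ℝ × specialOrthogonalGroup (Fin d) ℝ) :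
      ((p.1 : Matrix (Fin d) (Fin d) ℝ) * F * p.2).det = F.det := by
    rw [det_mul, det_mul, (mem_specialOrthogonalGroup_iff.1 p.1.2).2,
      (mem_specialOrthogonalGroup_iff.1 p.2.2).2, one_mul, mul_one]
  rcases hd with rfl | rfl
  · let A (p : specialOrthogonalGroup (Fin 2) ℝ × specialOrthogonalGroup (Fin 2) ℝ)
        (x : Matrix (Fin 2) (Fin 2) ℝ × ℝ) : Fin (2 ^ 2 - 1) → ℝ :=
      ![((p.1 : Matrix (Fin 2) (Fin 2) ℝ) * x.1 * p.2) 0 0,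
        ((p.1 : Matrix (Fin 2) (Fin 2) ℝ) * x.1 * p.2) 1 1, x.2]
    refine ⟨fun x => ⨆ p, g (A p x), IsLscConvex.iSup fun p => hg.comp ?_ ?_, fun F => ?_⟩
    · refine continuous_pi fun i => ?_
      have : Continuous fun x : Matrix (Fin 2) (Fin 2) ℝ × ℝ =>
          (p.1 : Matrix (Fin 2) (Fin 2) ℝ) * x.1 * p.2 := by fun_prop
      fin_cases i
      · exact this.matrix_elem 0 0
      · exact this.matrix_elem 1 1
      · exact continuous_snd
    · intro x y a b _
      simp [A, mul_add, add_mul]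
    · simp only [rotationEnvelope, diagMinors, A, hdet]
  · let A (p : specialOrthogonalGroup (Fin 3) ℝ × specialOrthogonalGroup (Fin 3) ℝ)
        (x : Matrix (Fin 3) (Fin 3) ℝ × Matrix (Fin 3) (Fin 3) ℝ × ℝ) : Fin (2 ^ 3 - 1) → ℝ :=
      ![((p.1 : Matrix (Fin 3) (Fin 3) ℝ) * x.1 * p.2) 0 0,
        ((p.1 : Matrix (Fin 3) (Fin 3) ℝ) * x.1 * p.2) 1 1,
        ((p.1 : Matrix (Fin 3) (Fin 3) ℝ) * x.1 * p.2) 2 2,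
        ((p.2 : Matrix (Fin 3) (Fin 3) ℝ).adjugate *
          (x.2.1 * (p.1 : Matrix (Fin 3) (Fin 3) ℝ).adjugate)) 0 0,
        ((p.2 : Matrix (Fin 3) (Fin 3) ℝ).adjugate *
          (x.2.1 * (p.1 : Matrix (Fin 3) (Fin 3) ℝ).adjugate)) 1 1,
        ((p.2 : Matrix (Fin 3) (Fin 3) ℝ).adjugate *
          (x.2.1 * (p.1 : Matrix (Fin 3) (Fin 3) ℝ).adjugate)) 2 2, x.2.2]
    refine ⟨fun x => ⨆ p, g (A p x), IsLscConvex.iSup fun p => hg.comp ?_ ?_, fun F => ?_⟩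
    · refine continuous_pi fun i => ?_
      have h1 : Continuous fun x : Matrix (Fin 3) (Fin 3) ℝ × Matrix (Fin 3) (Fin 3) ℝ × ℝ =>
          (p.1 : Matrix (Fin 3) (Fin 3) ℝ) * x.1 * p.2 := by fun_prop
      have h2 : Continuous fun x : Matrix (Fin 3) (Fin 3) ℝ × Matrix (Fin 3) (Fin 3) ℝ × ℝ =>
          (p.2 : Matrix (Fin 3) (Fin 3) ℝ).adjugate *
          (x.2.1 * (p.1 : Matrix (Fin 3) (Fin 3) ℝ).adjugate) := by
        fun_prop
      fin_cases i
      · exact h1.matrix_elem 0 0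
      · exact h1.matrix_elem 1 1
      · exact h1.matrix_elem 2 2
      · exact h2.matrix_elem 0 0
      · exact h2.matrix_elem 1 1
      · exact h2.matrix_elem 2 2
      · exact continuous_snd.snd
    · intro x y a b _
      simp [A, mul_add, add_mul]
    · simp only [rotationEnvelope, diagMinors, A, hdet, adjugate_mul_distrib]

theorem IsSignedSingularValues.signedPerm_mulVec {d : ℕ} {F : Matrix (Fin d) (Fin d) ℝ}
    {ν : Fin d → ℝ} (h : IsSignedSingularValues F ν) {S : Matrix (Fin d) (Fin d) ℝ}
    (hS : S ∈ signedPerms d) : IsSignedSingularValues F (S *ᵥ ν) := by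
  obtain ⟨σ, ε, hε, hprod, rfl⟩ := hS
  have hmul (i : Fin d) : ((σ.permMatrix ℝ * diagonal ε) *ᵥ ν) i = ε (σ i) * ν (σ i) := by
    rw [← mulVec_mulVec, PEquiv.toMatrix_toPEquiv_mulVec, Function.comp_apply, mulVec_diagonal]
  obtain ⟨⟨τ, hτ⟩, hs⟩ := h
  refine ⟨⟨σ.trans τ, fun i => ?_⟩, ?_⟩
  · rw [hmul, abs_mul, Equiv.trans_apply, ← hτ]
    rcases hε (σ i) with h | h <;> simp [h]
  · simp only [hmul]
    rw [Equiv.prod_comp σ fun i => ε i * ν i, Finset.prod_mul_distrib, hprod, one_mul, hs]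

theorem isLscSvpc_rotationEnvelope_diagonal {d : ℕ} (hd : d = 2 ∨ d = 3)
    {g : (Fin (2 ^ d - 1) → ℝ) → EReal} (hg : IsLscConvex g) :
    IsLscSvpc fun ν : Fin d → ℝ => rotationEnvelope g (diagonal ν) := by
  have : NeZero d := ⟨by omega⟩
  have hW (F : Matrix (Fin d) (Fin d) ℝ) (ν : Fin d → ℝ) (h : IsSignedSingularValues F ν) :
      rotationEnvelope g F = rotationEnvelope g (diagonal ν) := by
    obtain ⟨Q, hQ, R, hR, rfl⟩ := h.exists_rotations
    exact rotationEnvelope_mul_mul g _ hQ hR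
  refine ⟨fun ν h => hg.ne_bot _ (iSup_eq_bot.1 h 1), fun S hS ν => ?_, rotationEnvelope g, hW,
    isLscPolyconvex_rotationEnvelope hd hg⟩
  exact (hW _ _ ((isSignedSingularValues_diagonal ν).signedPerm_mulVec hS)).symm

/-- Jensen's inequality for `g`: the diagonal minors of `Q diag(ν) R` lie in the convex hull of the
minors of the vectors `S ν`, `S ∈ signedPerms d`, where `g` is at most `Φ (S ν) = Φ ν`. -/
theorem rotationEnvelope_diagonal_le {d : ℕ} (hd : d = 2 ∨ d = 3) {Φ : (Fin d → ℝ) → EReal}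
    (hΦ : IsPiInvariant Φ) {g : (Fin (2 ^ d - 1) → ℝ) → EReal} (hg : IsLscConvex g)
    (hle : ∀ ν, g (minors d ν) ≤ Φ ν) (ν : Fin d → ℝ) :
    rotationEnvelope g (diagonal ν) ≤ Φ ν := by
  refine iSup_le fun p => ?_
  rw [diagMinors_mul_diagonal_mul hd ν p.1.2 p.2.2]
  have hcont : Continuous (affineMinors d ν) := by
    rcases hd with rfl | rfl
    · refine continuous_pi fun i => ?_
      fin_cases i <;> simp [affineMinors, mulVec, dotProduct] <;> fun_prop
    · refine continuous_pi fun i => ?_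
      fin_cases i <;> simp [affineMinors, mulVec, dotProduct] <;> fun_prop
  refine convexHull_min ?_ ((hg.comp hcont (affineMinors_add_smul hd ν)).convex_sublevel (Φ ν))
    (entrywise_mul_mem_convexHull_signedPerms hd p.1.2 p.2.2)
  intro S hS
  change g (affineMinors d ν S) ≤ Φ ν
  rw [affineMinors_of_mem_signedPerms hd ν hS, ← hΦ S hS ν]
  exact hle _

/-- A lower semicontinuous singular value polyconvex function is a lower semicontinuous convex
function of the minors, namely the restriction of the polyconvex representative to the minors of
diagonal matrices. -/
theorem IsLscSvpc.exists_isLscConvex {d : ℕ} (hd : d = 2 ∨ d = 3) {Ψ : (Fin d → ℝ) → EReal}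
    (hΨ : IsLscSvpc Ψ) :
    ∃ g : (Fin (2 ^ d - 1) → ℝ) → EReal, IsLscConvex g ∧ ∀ ν, g (minors d ν) = Ψ ν := by
  obtain ⟨W, hW, hpoly⟩ := hΨ.polyconvex
  have hm := diagMinors_diagonal hd
  rcases hd with rfl | rfl
  · obtain ⟨G, hG, hWG⟩ := hpoly
    let A (x : Fin 3 → ℝ) : Matrix (Fin 2) (Fin 2) ℝ × ℝ := (diagonal ![x 0, x 1], x 2)
    have hA (ν) : (diagonal ν, (diagonal ν).det) = A (minors 2 ν) := by
      rw [← hm]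
      ext i j
      · fin_cases i <;> fin_cases j <;> simp [A, diagMinors]
      · simp [A, diagMinors]
    have hGA : IsLscConvex fun x => G (A x) := by
      refine hG.comp ?_ fun x y a b _ => ?_
      · refine (Continuous.matrix_diagonal (continuous_pi fun i => ?_)).prodMk (continuous_apply 2)
        fin_cases i
        exacts [continuous_apply 0, continuous_apply 1]
      · ext i j
        · fin_cases i <;> fin_cases j <;> simp [A]
        · simp [A]
    exact ⟨_, hGA, fun ν => by rw [← hW _ ν (isSignedSingularValues_diagonal ν), hWG, hA]⟩
  · obtain ⟨G, hG, hWG⟩ := hpoly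
    let A (x : Fin 7 → ℝ) : Matrix (Fin 3) (Fin 3) ℝ × Matrix (Fin 3) (Fin 3) ℝ × ℝ :=
      (diagonal ![x 0, x 1, x 2], diagonal ![x 3, x 4, x 5], x 6)
    have hA (ν) : (diagonal ν, (diagonal ν).adjugate, (diagonal ν).det) = A (minors 3 ν) := by
      rw [← hm]
      ext i j
      · fin_cases i <;> fin_cases j <;> simp [A, diagMinors]
      · fin_cases i <;> fin_cases j <;> simp [A, diagMinors, adjugate_diagonal]
      · simp [A, diagMinors]
    have hGA : IsLscConvex fun x => G (A x) := by
      refine hG.comp ?_ fun x y a b _ => ?_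
      · refine (Continuous.matrix_diagonal (continuous_pi fun i => ?_)).prodMk
          ((Continuous.matrix_diagonal (continuous_pi fun i => ?_)).prodMk (continuous_apply 6)) <;>
          fin_cases i
        exacts [continuous_apply 0, continuous_apply 1, continuous_apply 2, continuous_apply 3,
          continuous_apply 4, continuous_apply 5]
      · ext i j
        · fin_cases i <;> fin_cases j <;> simp [A]
        · fin_cases i <;> fin_cases j <;> simp [A]
        · simp [A]
    exact ⟨_, hGA, fun ν => by rw [← hW _ ν (isSignedSingularValues_diagonal ν), hWG, hA]⟩

end SVPoly

theorem proposition2p3 (d : ℕ) (hd : d = 2 ∨ d = 3) (Φ : (Fin d → ℝ) → EReal)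
    (hbot : ∀ ν, Φ ν ≠ ⊥) (hΦ : SVPoly.IsPiInvariant Φ) :
    SVPoly.lscSvpcEnvelope Φ =
      SVPoly.lscConvexEnvelope (SVPoly.liftToMinors Φ) ∘ SVPoly.minors d := by
  funext ν
  apply le_antisymm
  · refine iSup_le fun Ψ => iSup_le fun hΨ => iSup_le fun hle => ?_
    obtain ⟨g, hg, hgΨ⟩ := hΨ.exists_isLscConvex hd
    have hgh : g ≤ SVPoly.liftToMinors Φ := by
      intro x
      by_cases hx : ∃ μ, SVPoly.minors d μ = x
      · obtain ⟨μ, rfl⟩ := hx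
        rw [SVPoly.liftToMinors_minors hd, hgΨ]
        exact hle μ
      · rw [SVPoly.liftToMinors, Function.extend_apply' _ _ _ hx]
        exact le_top
    rw [← hgΨ]
    exact le_iSup_of_le g (le_iSup₂_of_le hg hgh le_rfl)
  · refine iSup_le fun g => iSup_le fun hg => iSup_le fun hle => ?_
    have hle' (μ) : g (SVPoly.minors d μ) ≤ Φ μ := by
      rw [← SVPoly.liftToMinors_minors hd Φ μ]
      exact hle _
    refine le_iSup_of_le _ (le_iSup₂_of_le (SVPoly.isLscSvpc_rotationEnvelope_diagonal hd hg)
      (SVPoly.rotationEnvelope_diagonal_le hd hΦ hg hle') ?_)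
    refine le_iSup_of_le 1 (le_of_eq ?_)
    simp only [Prod.fst_one, Prod.snd_one, Submonoid.coe_one, one_mul, mul_one,
      SVPoly.diagMinors_diagonal hd]
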